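/- Let $\mathbb{C}$ be a regular category, i.e. a category with finite limits in which every morphism factors as a regular epimorphism followed by a monomorphism, and in which regular epimorphisms are stable under pullback. A relation from $X$ to $Y$ is a subobject $\langle r_1,r_2\rangle\colon R\rightarrowtail X\times Y$, and a relation on $X$ is a relation from $X$ to $X$; $R^{\circ}$ denotes the opposite relation, given by $\langle r_2,r_1\rangle\colon R\rightarrowtail Y\times X$. For relations $R$ from $X$ to $Y$ and $S$ from $Y$ to $Z$, the composite $SR$ is the image of $\langle r_1\pi_1,s_2\pi_2\rangle\colon R\times_Y S\to X\times Z$, where $R\times_Y S$ is the pullback of $r_2$ and $s_1$, with projections $\pi_1,\pi_2$. A relation $R$ on $X$ is reflexive if $1_X\leqslant R$, where $1_X$ is the relation $\langle 1_X,1_X\rangle\colon X\rightarrowtail X\times X$; symmetric if $R^{\circ}\leqslant R$; transitive if $RR\leqslant R$; an equivalence relation if it is reflexive, symmetric and transitive; and positive if $R=U^{\circ}U$ for some relation $U$ from $X$ to some object $Y$. For morphisms $x\colon A\to X$ and $y\colon A\to Y$ (generalised elements), $(x,y)\in R$ means that $\langle x,y\rangle\colon A\to X\times Y$ factors through $R\rightarrowtail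 X\times Y$. **Theorem.** The following conditions on the regular category $\mathbb{C}$ are equivalent: (i) $\mathbb{C}$ is a Goursat category, i.e. $RSR=SRS$ for all equivalence relations $R$ and $S$ on the same object of $\mathbb{C}$; (ii) the Shifting Lemma holds in $\mathbb{C}$ when $S$ is a reflexive relation and $R$ and $T$ are reflexive and positive relations; that is, for every object $X$, every reflexive relation $S$ on $X$ and all reflexive and positive relations $R$ and $T$ on $X$ with $R\wedge S\leqslant T$, and for all generalised elements $x,y,u,v\colon A\to X$ with common domain, $$(x,y)\in R\wedge T,\quad (x,u)\in S,\quad (y,v)\in S,\quad (u,v)\in R\quad\Longrightarrow\quad (u,v)\in T.$$ -/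

import Mathlib

open CategoryTheory CategoryTheory.Limits

universe v u

noncomputable section

namespace Goursat

variable {C : Type u} [Category.{v} C] [Regular C]

/-- An internal relation from `X` to `Y`: a subobject of `X ⨯ Y`. -/
abbrev InternalRel (X Y : C) := Subobject (X ⨯ Y)

namespace InternalRel

/-- The first leg `r₁ : R ⟶ X` of a relation `R` from `X` to `Y`. -/
abbrev leg₁ {X Y : C} (R : InternalRel X Y) : (R : C) ⟶ X := R.arrow ≫ prod.fst

/-- The second leg `r₂ : R ⟶ Y` of a relation `R` from `X` to `Y`. -/
abbrev leg₂ {X Y : C} (R : InternalRel X Y) : (R : C) ⟶ Y := R.arrow ≫ prod.snd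

instance mono_lift_leg₂_leg₁ {X Y : C} (R : InternalRel X Y) :
    Mono (prod.lift R.leg₂ R.leg₁) where
  right_cancellation g h w := by
    have w₁ := w =≫ prod.fst
    have w₂ := w =≫ prod.snd
    simp only [Category.assoc, prod.lift_fst, prod.lift_snd] at w₁ w₂
    rw [← cancel_mono R.arrow]
    apply Limits.prod.hom_ext <;> simpa using by assumption

instance mono_diag (X : C) : Mono (prod.lift (𝟙 X) (𝟙 X)) where
  right_cancellation g h w := by
    have w₁ := w =≫ prod.fst
    simpa only [Category.assoc, prod.lift_fst, Category.comp_id] using w₁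

/-- The identity relation `1_X`, given by `⟨1_X, 1_X⟩ : X ⟶ X ⨯ X`. -/
def identity (X : C) : InternalRel X X := Subobject.mk (prod.lift (𝟙 X) (𝟙 X))

/-- The opposite relation `R°` from `Y` to `X`, given by `⟨r₂, r₁⟩ : R ⟶ Y ⨯ X`. -/
def opposite {X Y : C} (R : InternalRel X Y) : InternalRel Y X :=
  Subobject.mk (prod.lift R.leg₂ R.leg₁)

/-- The relational composite `SR` (first `R`, then `S`): the image, in `X ⨯ Z`, of the morphism
`⟨r₁ π₁, s₂ π₂⟩` defined on the pullback of `r₂` and `s₁`. In a regular category, the image of a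
morphism is the monomorphic part of its (regular epimorphism, monomorphism) factorization. -/
def comp {X Y Z : C} (S : InternalRel Y Z) (R : InternalRel X Y) : InternalRel X Z :=
  imageSubobject
    (prod.lift (pullback.fst R.leg₂ S.leg₁ ≫ R.leg₁) (pullback.snd R.leg₂ S.leg₁ ≫ S.leg₂))

def IsReflexive {X : C} (R : InternalRel X X) : Prop := identity X ≤ R

def IsSymmetric {X : C} (R : InternalRel X X) : Prop := R.opposite ≤ R

def IsTransitive {X : C} (R : InternalRel X X) : Prop := R.comp R ≤ R

structure IsEquivalence {X : C} (R : InternalRel X X) : Prop where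
  refl : R.IsReflexive
  symm : R.IsSymmetric
  trans : R.IsTransitive

/-- `P` is positive when `P = U°U` for some relation `U` from `X` to some object `Y`. -/
def IsPositive {X : C} (P : InternalRel X X) : Prop :=
  ∃ (Y : C) (U : InternalRel X Y), P = U.opposite.comp U

/-- `(x, y) ∈ R` for generalised elements `x` of `X` and `y` of `Y` with common domain `A`:
the morphism `⟨x, y⟩ : A ⟶ X ⨯ Y` factors through the subobject `R`. -/
def Mem {X Y A : C} (R : InternalRel X Y) (x : A ⟶ X) (y : A ⟶ Y) : Prop :=
  R.Factors (prod.lift x y)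

end InternalRel

/-- The property of the diagram of the Shifting Lemma for three given relations `R`, `S`, `T` on
the same object `X`: if `R ∧ S ≤ T`, then for all generalised elements `x, y, u, v` of `X` with
`(x, y) ∈ R ∧ T`, `(x, u) ∈ S`, `(y, v) ∈ S` and `(u, v) ∈ R`, one has `(u, v) ∈ T`. -/
def ShiftingLemma {X : C} (R S T : InternalRel X X) : Prop :=
  R ⊓ S ≤ T → ∀ (A : C) (x y u v : A ⟶ X),
    InternalRel.Mem (R ⊓ T) x y → S.Mem x u → S.Mem y v → R.Mem u v → T.Mem u v

variable (C) in
/-- A regular category is a Goursat category when it is `3`-permutable: `RSR = SRS` for all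
equivalence relations `R` and `S` on the same object. -/
def IsGoursat : Prop :=
  ∀ (X : C) (R S : InternalRel X X), R.IsEquivalence → S.IsEquivalence →
    R.comp (S.comp R) = S.comp (R.comp S)

end Goursat

end

/-!
A relation with legs `f` and `g` is the composite of the opposite of the graph of `f` with the graph
of `g`; permuting the kernel pairs of `f` and `g` therefore shows that in a Goursat category every
positive relation `U°U` is transitive, so that reflexive positive relations are equivalence
relations. The Shifting Lemma for such `R` and `T` follows by applying this transitivity to the
relation `U` from `X ⨯ X` to `X` given by `(p, t) U w ↔ (p, w) ∈ S(R ∧ T) ∧ (t, w) ∈ R`, for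
which `(u, u) U u`, `(x, u) U u`, `(x, u) U v` and `(v, u) U v`.

Conversely, for equivalence relations `R` and `S` the composites `RSR` and `SRS` are reflexive and
positive, and shifting along the reflexive relation `R` turns an element of `RSR` into one of `SRS`.
-/

namespace Goursat

section

variable {C : Type u} [Category.{v} C]

theorem factors_of_factors_strongEpi_comp {A B X : C} {P : Subobject X} (p : B ⟶ A) [StrongEpi p]
    {f : A ⟶ X} (h : P.Factors (p ≫ f)) : P.Factors f := by
  have sq : CommSq (P.factorThru _ h) p P.arrow f := ⟨P.factorThru_arrow _ h⟩
  rw [← sq.fac_right]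
  exact Subobject.factors_comp_arrow sq.lift

theorem prod_lift_eq_prod_lift_iff [HasBinaryProducts C] {A X Y : C} {f f' : A ⟶ X}
    {g g' : A ⟶ Y} : prod.lift f g = prod.lift f' g' ↔ f = f' ∧ g = g' := by
  constructor
  · intro h
    have hfst := h =≫ prod.fst
    have hsnd := h =≫ prod.snd
    rw [prod.lift_fst, prod.lift_fst] at hfst
    rw [prod.lift_snd, prod.lift_snd] at hsnd
    exact ⟨hfst, hsnd⟩
  · rintro ⟨rfl, rfl⟩
    rfl

end

variable {C : Type u} [Category.{v} C] [Regular C]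

theorem imageSubobject_factors_iff {A X Y : C} {f : X ⟶ Y} {h : A ⟶ Y} :
    (imageSubobject f).Factors h ↔
      ∃ (B : C) (p : B ⟶ A) (k : B ⟶ X), IsRegularEpi p ∧ p ≫ h = k ≫ f := by
  constructor
  · intro hf
    have : StrongEpi (factorThruImageSubobject f) := strongEpi_comp _ _
    let t := (imageSubobject f).factorThru h hf
    refine ⟨pullback (factorThruImageSubobject f) t, pullback.snd _ _, pullback.fst _ _,
      inferInstance, ?_⟩
    calc pullback.snd _ t ≫ h
      _ = pullback.snd _ t ≫ t ≫ (imageSubobject f).arrow := by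
        rw [(imageSubobject f).factorThru_arrow]
      _ = pullback.fst _ t ≫ factorThruImageSubobject f ≫ (imageSubobject f).arrow := by
        rw [pullback.condition_assoc]
      _ = pullback.fst _ t ≫ f := by rw [imageSubobject_arrow_comp]
  · rintro ⟨B, p, k, _, hk⟩
    exact factors_of_factors_strongEpi_comp p (hk ▸ imageSubobject_factors_comp_self f k)

namespace InternalRel

variable {A B W X Y Z : C}

theorem mem_mk_lift {f : B ⟶ X} {g : B ⟶ Y} [Mono (prod.lift f g)] {x : A ⟶ X} {y : A ⟶ Y} :
    Mem (Subobject.mk (prod.lift f g)) x y ↔ ∃ r : A ⟶ B, r ≫ f = x ∧ r ≫ g = y := by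
  rw [Mem, Subobject.mk_factors_iff]
  change (∃ r : A ⟶ B, r ≫ prod.lift f g = prod.lift x y) ↔ _
  simp only [prod.comp_lift, prod_lift_eq_prod_lift_iff]

theorem lift_legs (R : InternalRel X Y) : prod.lift R.leg₁ R.leg₂ = R.arrow := by
  rw [← prod.comp_lift, prod.lift_fst_snd, Category.comp_id]

theorem mem_iff {R : InternalRel X Y} {x : A ⟶ X} {y : A ⟶ Y} :
    R.Mem x y ↔ ∃ r : A ⟶ (R : C), r ≫ R.leg₁ = x ∧ r ≫ R.leg₂ = y := by
  have : Mono (prod.lift R.leg₁ R.leg₂) := R.lift_legs ▸ inferInstance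
  rw [← mem_mk_lift]
  simp only [lift_legs, Subobject.mk_arrow]

theorem Mem.precomp {R : InternalRel X Y} {x : A ⟶ X} {y : A ⟶ Y} (h : R.Mem x y) (p : B ⟶ A) :
    R.Mem (p ≫ x) (p ≫ y) := by
  rw [Mem, ← prod.comp_lift]
  exact Subobject.factors_of_factors_right p h

theorem Mem.of_precomp {R : InternalRel X Y} (p : B ⟶ A) [StrongEpi p] {x : A ⟶ X} {y : A ⟶ Y}
    (h : R.Mem (p ≫ x) (p ≫ y)) : R.Mem x y := by
  rw [Mem, ← prod.comp_lift] at h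
  exact factors_of_factors_strongEpi_comp p h

theorem Mem.mono {R S : InternalRel X Y} {x : A ⟶ X} {y : A ⟶ Y} (h : R.Mem x y) (hRS : R ≤ S) :
    S.Mem x y :=
  Subobject.factors_of_le _ hRS h

theorem le_iff_mem {R S : InternalRel X Y} :
    R ≤ S ↔ ∀ {A : C} {x : A ⟶ X} {y : A ⟶ Y}, R.Mem x y → S.Mem x y := by
  refine ⟨fun hRS _ _ _ h => h.mono hRS, fun h => Subobject.le_of_factors ?_⟩
  rw [← lift_legs]
  exact h (mem_iff.2 ⟨𝟙 _, Category.id_comp _, Category.id_comp _⟩)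

theorem ext_mem {R S : InternalRel X Y}
    (h : ∀ {A : C} {x : A ⟶ X} {y : A ⟶ Y}, R.Mem x y ↔ S.Mem x y) : R = S :=
  le_antisymm (le_iff_mem.2 h.1) (le_iff_mem.2 h.2)

theorem mem_inf {R S : InternalRel X Y} {x : A ⟶ X} {y : A ⟶ Y} :
    (R ⊓ S).Mem x y ↔ R.Mem x y ∧ S.Mem x y :=
  Subobject.inf_factors _

theorem mem_identity {x y : A ⟶ X} : (identity X).Mem x y ↔ x = y := by
  simp [identity, mem_mk_lift]

theorem mem_opposite {R : InternalRel X Y} {x : A ⟶ X} {y : A ⟶ Y} :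
    R.opposite.Mem y x ↔ R.Mem x y := by
  rw [opposite, mem_mk_lift, mem_iff]
  simp only [and_comm]

theorem mem_comp {S : InternalRel Y Z} {R : InternalRel X Y} {x : A ⟶ X} {z : A ⟶ Z} :
    (S.comp R).Mem x z ↔ ∃ (B : C) (p : B ⟶ A) (y : B ⟶ Y),
      IsRegularEpi p ∧ R.Mem (p ≫ x) y ∧ S.Mem y (p ≫ z) := by
  simp only [Mem, comp, imageSubobject_factors_iff, prod.comp_lift, prod_lift_eq_prod_lift_iff]
  constructor
  · rintro ⟨B, p, k, hp, hx, hz⟩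
    refine ⟨B, p, k ≫ pullback.fst _ _ ≫ R.leg₂, hp, mem_iff.2 ⟨k ≫ pullback.fst _ _, ?_, ?_⟩,
      mem_iff.2 ⟨k ≫ pullback.snd _ _, ?_, ?_⟩⟩
    · rw [hx, Category.assoc]
    · rw [Category.assoc]
    · rw [Category.assoc, pullback.condition]
    · rw [hz, Category.assoc]
  · rintro ⟨B, p, y, hp, hxy, hyz⟩
    obtain ⟨r, hrx, hry⟩ := mem_iff.1 hxy
    obtain ⟨s, hsy, hsz⟩ := mem_iff.1 hyz
    refine ⟨B, p, pullback.lift r s (hry.trans hsy.symm), hp, ?_, ?_⟩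
    · rw [pullback.lift_fst_assoc, hrx]
    · rw [pullback.lift_snd_assoc, hsz]

theorem Mem.comp {S : InternalRel Y Z} {R : InternalRel X Y} {x : A ⟶ X} {y : A ⟶ Y}
    {z : A ⟶ Z} (hxy : R.Mem x y) (hyz : S.Mem y z) : (S.comp R).Mem x z :=
  mem_comp.2 ⟨A, 𝟙 A, y, inferInstance, by rwa [Category.id_comp], by rwa [Category.id_comp]⟩

theorem comp_le_iff {S : InternalRel Y Z} {R : InternalRel X Y} {T : InternalRel X Z} :
    S.comp R ≤ T ↔ ∀ {A : C} {x : A ⟶ X} {y : A ⟶ Y} {z : A ⟶ Z},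
      R.Mem x y → S.Mem y z → T.Mem x z := by
  refine ⟨fun h _ _ _ _ hxy hyz => (hxy.comp hyz).mono h, fun h => le_iff_mem.2 fun hxz => ?_⟩
  obtain ⟨B, p, y, _, hxy, hyz⟩ := mem_comp.1 hxz
  exact .of_precomp p (h hxy hyz)

theorem comp_assoc (T : InternalRel Z W) (S : InternalRel Y Z) (R : InternalRel X Y) :
    (T.comp S).comp R = T.comp (S.comp R) := by
  apply le_antisymm
  · refine comp_le_iff.2 fun hxy hyw => ?_
    obtain ⟨B, p, z, _, hyz, hzw⟩ := mem_comp.1 hyw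
    exact .of_precomp p (((hxy.precomp p).comp hyz).comp hzw)
  · refine comp_le_iff.2 fun hxz hzw => ?_
    obtain ⟨B, p, y, _, hxy, hyz⟩ := mem_comp.1 hxz
    exact .of_precomp p (hxy.comp (hyz.comp (hzw.precomp p)))

theorem opposite_opposite (R : InternalRel X Y) : R.opposite.opposite = R :=
  ext_mem (mem_opposite.trans mem_opposite)

theorem opposite_comp (S : InternalRel Y Z) (R : InternalRel X Y) :
    (S.comp R).opposite = R.opposite.comp S.opposite :=
  ext_mem <| by simp only [mem_opposite, mem_comp, and_comm, implies_true]

theorem isReflexive_iff {R : InternalRel X X} :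
    R.IsReflexive ↔ ∀ {A : C} (x : A ⟶ X), R.Mem x x :=
  ⟨fun h _ _ => (mem_identity.2 rfl).mono h,
    fun h => le_iff_mem.2 fun hxy => mem_identity.1 hxy ▸ h _⟩

theorem isSymmetric_iff {R : InternalRel X X} :
    R.IsSymmetric ↔ ∀ {A : C} {x y : A ⟶ X}, R.Mem x y → R.Mem y x :=
  ⟨fun h _ _ _ hxy => (mem_opposite.2 hxy).mono h,
    fun h => le_iff_mem.2 fun hxy => h (mem_opposite.1 hxy)⟩

theorem isTransitive_iff {R : InternalRel X X} :
    R.IsTransitive ↔ ∀ {A : C} {x y z : A ⟶ X}, R.Mem x y → R.Mem y z → R.Mem x z :=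
  comp_le_iff

theorem IsReflexive.comp {R S : InternalRel X X} (hS : S.IsReflexive) (hR : R.IsReflexive) :
    (S.comp R).IsReflexive :=
  isReflexive_iff.2 fun x => (isReflexive_iff.1 hR x).comp (isReflexive_iff.1 hS x)

theorem IsSymmetric.opposite_eq {R : InternalRel X X} (h : R.IsSymmetric) : R.opposite = R :=
  le_antisymm h (le_iff_mem.2 fun hxy => mem_opposite.2 (isSymmetric_iff.1 h hxy))

theorem IsEquivalence.comp_self {R : InternalRel X X} (h : R.IsEquivalence) : R.comp R = R :=
  le_antisymm h.trans (le_iff_mem.2 fun hxy => hxy.comp (isReflexive_iff.1 h.refl _))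

theorem isSymmetric_opposite_comp (U : InternalRel X Y) : (U.opposite.comp U).IsSymmetric := by
  rw [IsSymmetric, opposite_comp, opposite_opposite]

theorem IsEquivalence.isPositive {R : InternalRel X X} (h : R.IsEquivalence) : R.IsPositive :=
  ⟨X, R, by rw [h.symm.opposite_eq, h.comp_self]⟩

theorem IsPositive.opposite_comp_comp {P : InternalRel Y Y} (hP : P.IsPositive)
    (R : InternalRel X Y) : (R.opposite.comp (P.comp R)).IsPositive := by
  obtain ⟨Z, U, rfl⟩ := hP
  exact ⟨Z, U.comp R, by simp only [opposite_comp, comp_assoc]⟩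

theorem IsPositive.comp_comp {P R : InternalRel X X} (hP : P.IsPositive) (hR : R.IsSymmetric) :
    (R.comp (P.comp R)).IsPositive := by
  have h := hP.opposite_comp_comp R
  rwa [hR.opposite_eq] at h

instance mono_lift_id (f : X ⟶ Y) : Mono (prod.lift (𝟙 X) f) :=
  mono_of_mono_fac (prod.lift_fst (𝟙 X) f)

/-- A morphism `f : X ⟶ Y` regarded as the relation `⟨1_X, f⟩ : X ⟶ X ⨯ Y` from `X` to `Y`. -/
noncomputable def graph (f : X ⟶ Y) : InternalRel X Y := Subobject.mk (prod.lift (𝟙 X) f)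

theorem mem_graph {f : X ⟶ Y} {x : A ⟶ X} {y : A ⟶ Y} : (graph f).Mem x y ↔ x ≫ f = y := by
  simp [graph, mem_mk_lift]

theorem mem_comp_graph {R : InternalRel Y Z} {f : X ⟶ Y} {x : A ⟶ X} {z : A ⟶ Z} :
    (R.comp (graph f)).Mem x z ↔ R.Mem (x ≫ f) z := by
  refine ⟨fun h => ?_, (mem_graph.2 rfl).comp⟩
  obtain ⟨B, p, y, _, hxy, hyz⟩ := mem_comp.1 h
  rw [mem_graph, Category.assoc] at hxy
  exact .of_precomp p (hxy ▸ hyz)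

theorem exists_eq_graph_comp_opposite_graph (R : InternalRel X Y) :
    ∃ (E : C) (f : E ⟶ X) (g : E ⟶ Y), R = (graph g).comp (graph f).opposite := by
  refine ⟨(R : C), R.leg₁, R.leg₂, le_antisymm (le_iff_mem.2 fun h => ?_)
    (comp_le_iff.2 fun hx hy => ?_)⟩
  · obtain ⟨r, hx, hy⟩ := mem_iff.1 h
    exact (mem_opposite.2 (mem_graph.2 hx)).comp (mem_graph.2 hy)
  · exact mem_iff.2 ⟨_, mem_graph.1 (mem_opposite.1 hx), mem_graph.1 hy⟩

/-- The kernel pair `f°f` of a morphism `f : X ⟶ Y`, as a relation on `X`. -/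
noncomputable def kernelPair (f : X ⟶ Y) : InternalRel X X := (graph f).opposite.comp (graph f)

theorem mem_kernelPair {f : X ⟶ Y} {x y : A ⟶ X} : (kernelPair f).Mem x y ↔ x ≫ f = y ≫ f := by
  rw [kernelPair, mem_comp_graph, mem_opposite, mem_graph, eq_comm]

theorem isEquivalence_kernelPair (f : X ⟶ Y) : (kernelPair f).IsEquivalence where
  refl := isReflexive_iff.2 fun _ => mem_kernelPair.2 rfl
  symm := isSymmetric_opposite_comp (graph f)
  trans := isTransitive_iff.2 fun hxy hyz =>
    mem_kernelPair.2 ((mem_kernelPair.1 hxy).trans (mem_kernelPair.1 hyz))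

theorem graph_comp_kernelPair (f : X ⟶ Y) : (graph f).comp (kernelPair f) = graph f := by
  apply le_antisymm
  · refine comp_le_iff.2 fun hxy hyz => mem_graph.2 ?_
    rw [mem_kernelPair.1 hxy, mem_graph.1 hyz]
  · exact le_iff_mem.2 fun hxy => (mem_kernelPair.2 rfl).comp hxy

theorem kernelPair_comp_opposite_graph (f : X ⟶ Y) :
    (kernelPair f).comp (graph f).opposite = (graph f).opposite := by
  rw [← (isEquivalence_kernelPair f).symm.opposite_eq, ← opposite_comp, graph_comp_kernelPair]

theorem comp_inf_inf_le {R S T : InternalRel X X} (hRsymm : R.IsSymmetric)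
    (hRtrans : R.IsTransitive) (hT : T.IsTransitive) (hRST : R ⊓ S ≤ T) :
    S.comp (R ⊓ T) ⊓ R ≤ T := by
  refine le_iff_mem.2 fun h => ?_
  obtain ⟨hST, hac⟩ := mem_inf.1 h
  obtain ⟨B, p, b, _, hab, hbc⟩ := mem_comp.1 hST
  obtain ⟨hRab, hTab⟩ := mem_inf.1 hab
  have hRbc := isTransitive_iff.1 hRtrans (isSymmetric_iff.1 hRsymm hRab) (hac.precomp p)
  exact .of_precomp p (isTransitive_iff.1 hT hTab ((mem_inf.2 ⟨hRbc, hbc⟩).mono hRST))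

end InternalRel

open InternalRel

theorem IsGoursat.isTransitive_opposite_comp (hC : IsGoursat C) {X Y : C} (U : InternalRel X Y) :
    (U.opposite.comp U).IsTransitive := by
  obtain ⟨E, f, g, rfl⟩ := U.exists_eq_graph_comp_opposite_graph
  let F := kernelPair f
  let G := kernelPair g
  have hFGF : F.comp (G.comp F) = G.comp (F.comp G) :=
    hC E F G (isEquivalence_kernelPair f) (isEquivalence_kernelPair g)
  have hUU : ((graph g).comp (graph f).opposite).opposite.comp
      ((graph g).comp (graph f).opposite) = (graph f).comp (G.comp (graph f).opposite) := by
    simp only [G, kernelPair, opposite_comp, opposite_opposite, comp_assoc]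
  rw [hUU]
  refine le_of_eq ?_
  calc ((graph f).comp (G.comp (graph f).opposite)).comp
        ((graph f).comp (G.comp (graph f).opposite))
    _ = (graph f).comp ((G.comp (F.comp G)).comp (graph f).opposite) := by
      simp only [F, kernelPair, comp_assoc]
    _ = (graph f).comp ((F.comp (G.comp F)).comp (graph f).opposite) := by rw [hFGF]
    _ = ((graph f).comp F).comp (G.comp (F.comp (graph f).opposite)) := by
      simp only [comp_assoc]
    _ = (graph f).comp (G.comp (graph f).opposite) := by
      rw [graph_comp_kernelPair, kernelPair_comp_opposite_graph]

theorem IsGoursat.isEquivalence_of_isPositive (hC : IsGoursat C) {X : C} {P : InternalRel X X}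
    (hrefl : P.IsReflexive) (hpos : P.IsPositive) : P.IsEquivalence := by
  obtain ⟨Y, U, rfl⟩ := hpos
  exact ⟨hrefl, isSymmetric_opposite_comp U, hC.isTransitive_opposite_comp U⟩

theorem IsGoursat.shiftingLemma (hC : IsGoursat C) {X : C} {R S T : InternalRel X X}
    (hR : R.IsEquivalence) (hS : S.IsReflexive) (hT : T.IsEquivalence) :
    ShiftingLemma R S T := by
  intro hRST A x y u v hxy hxu hyv huv
  have hRrefl {B : C} (b : B ⟶ X) : R.Mem b b := isReflexive_iff.1 hR.refl b
  have hRT {B : C} (b : B ⟶ X) : (R ⊓ T).Mem b b :=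
    mem_inf.2 ⟨hRrefl b, isReflexive_iff.1 hT.refl b⟩
  have hSRT {B : C} (b : B ⟶ X) : (S.comp (R ⊓ T)).Mem b b :=
    (hRT b).comp (isReflexive_iff.1 hS b)
  let U : InternalRel (X ⨯ X) X :=
    (S.comp (R ⊓ T)).comp (graph prod.fst) ⊓ R.comp (graph prod.snd)
  have mem_U {B : C} {a b c : B ⟶ X} :
      U.Mem (prod.lift a b) c ↔ (S.comp (R ⊓ T)).Mem a c ∧ R.Mem b c := by
    simp only [U, mem_inf, mem_comp_graph, prod.lift_fst, prod.lift_snd]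
  have huu : U.Mem (prod.lift u u) u := mem_U.2 ⟨hSRT u, hRrefl u⟩
  have hxuu : U.Mem (prod.lift x u) u := mem_U.2 ⟨(hRT x).comp hxu, hRrefl u⟩
  have hxuv : U.Mem (prod.lift x u) v := mem_U.2 ⟨hxy.comp hyv, huv⟩
  have hvuv : U.Mem (prod.lift v u) v := mem_U.2 ⟨hSRT v, huv⟩
  have huuvu : (U.opposite.comp U).Mem (prod.lift u u) (prod.lift v u) :=
    isTransitive_iff.1 (hC.isTransitive_opposite_comp U)
      (huu.comp (mem_opposite.2 hxuu)) (hxuv.comp (mem_opposite.2 hvuv))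
  obtain ⟨B, p, w, _, huw, hwv⟩ := mem_comp.1 huuvu
  rw [prod.comp_lift, mem_U] at huw
  rw [mem_opposite, prod.comp_lift, mem_U] at hwv
  have hRvw : R.Mem (p ≫ v) w :=
    isTransitive_iff.1 hR.trans (isSymmetric_iff.1 hR.symm (huv.precomp p)) huw.2
  have hT_of_mem {a : B ⟶ X} (hSRTaw : (S.comp (R ⊓ T)).Mem a w) (hRaw : R.Mem a w) : T.Mem a w :=
    (mem_inf.2 ⟨hSRTaw, hRaw⟩).mono (comp_inf_inf_le hR.symm hR.trans hT.trans hRST)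
  have hTuw : T.Mem (p ≫ u) w := hT_of_mem huw.1 huw.2
  have hTvw : T.Mem (p ≫ v) w := hT_of_mem hwv.1 hRvw
  exact .of_precomp p (isTransitive_iff.1 hT.trans hTuw (isSymmetric_iff.1 hT.symm hTvw))

theorem comp_comp_le_of_shiftingLemma {X : C} {R S : InternalRel X X} (hRrefl : R.IsReflexive)
    (hRsymm : R.IsSymmetric) (hS : S.IsReflexive)
    (h : ShiftingLemma (R.comp (S.comp R)) R (S.comp (R.comp S))) :
    R.comp (S.comp R) ≤ S.comp (R.comp S) := by
  have hRmem {A : C} (a : A ⟶ X) : R.Mem a a := isReflexive_iff.1 hRrefl a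
  have hSmem {A : C} (a : A ⟶ X) : S.Mem a a := isReflexive_iff.1 hS a
  have hR_le : R ≤ S.comp (R.comp S) :=
    le_iff_mem.2 fun hab => ((hSmem _).comp hab).comp (hSmem _)
  have hS_le {A : C} {a b : A ⟶ X} (hab : S.Mem a b) :
      (R.comp (S.comp R) ⊓ S.comp (R.comp S)).Mem a b :=
    mem_inf.2 ⟨((hRmem a).comp hab).comp (hRmem b), (hab.comp (hRmem b)).comp (hSmem b)⟩
  rw [← comp_assoc]
  refine comp_le_iff.2 fun {A u x v} hux hxv => ?_
  obtain ⟨B, p, y, _, hxy, hyv⟩ := mem_comp.1 hxv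
  have hpux := hux.precomp p
  exact .of_precomp p <| h (inf_le_right.trans hR_le) B (p ≫ x) y (p ≫ u) (p ≫ v) (hS_le hxy)
    (isSymmetric_iff.1 hRsymm hpux) hyv ((hpux.comp hxy).comp hyv)

end Goursat

theorem theorem3p5 (C : Type u) [CategoryTheory.Category.{v} C] [CategoryTheory.Regular C] :
    Goursat.IsGoursat C ↔
      ∀ (X : C) (R S T : Goursat.InternalRel X X),
        S.IsReflexive →
        R.IsReflexive → R.IsPositive →
        T.IsReflexive → T.IsPositive →
        Goursat.ShiftingLemma R S T := by
  constructor
  · intro hC X R S T hS hR hR' hT hT'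
    exact hC.shiftingLemma (hC.isEquivalence_of_isPositive hR hR') hS
      (hC.isEquivalence_of_isPositive hT hT')
  · intro h X R S hR hS
    have key {R S : Goursat.InternalRel X X} (hR : R.IsEquivalence) (hS : S.IsEquivalence) :
        R.comp (S.comp R) ≤ S.comp (R.comp S) :=
      Goursat.comp_comp_le_of_shiftingLemma hR.refl hR.symm hS.refl <|
        h X _ R _ hR.refl
          (hR.refl.comp (hS.refl.comp hR.refl)) (hS.isPositive.comp_comp hR.symm)
          (hS.refl.comp (hR.refl.comp hS.refl)) (hR.isPositive.comp_comp hS.symm)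
    exact le_antisymm (key hR hS) (key hS hR)
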